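/- A group $\Gamma$ is called \emph{LEF} (locally embeddable into finite groups) if for every finite subset $A \subseteq \Gamma$ there are a finite group $Q$ and an injective function $\phi : A \to Q$ such that $\phi(gh) = \phi(g)\phi(h)$ for all $g,h \in A$ with $gh \in A$. Let $X = (V,E)$ be any simple graph (the vertex set $V$ may be infinite), and let $\underline{H} = (H_v)_{v \in V}$ be a family of groups. The \emph{graph product} $P(\underline{H},X)$ is the quotient of the free product $\ast_{v \in V} H_v$ by the normal closure of the set of all elements $h^{-1}k^{-1}hk$ with $h \in H_v$, $k \in H_w$ and $v,w \in V$ adjacent in $X$. If every $H_v$ is LEF, then $P(\underline{H},X)$ is LEF. -/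

import Mathlib

/-- A function `φ` on a subset `A` of a group `Γ` with values in a group `Δ` is a partial
homomorphism if `φ (g h) = φ g * φ h` whenever `g`, `h` and `g h` all lie in `A`. -/
def IsPartialHom {Γ Δ : Type*} [Group Γ] [Group Δ] (A : Set Γ) (φ : A → Δ) : Prop :=
  ∀ (g h : A) (hgh : (g : Γ) * (h : Γ) ∈ A), φ ⟨(g : Γ) * (h : Γ), hgh⟩ = φ g * φ h

/-- A group is LEF (locally embeddable into finite groups) if every finite subset admits an
injective partial homomorphism to a finite group. Every finite group is isomorphic to one whose
underlying type is in `Type`, so the universe of `Q` is no restriction. -/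
def IsLEF (Γ : Type*) [Group Γ] : Prop :=
  ∀ A : Set Γ, A.Finite → ∃ (Q : Type) (_ : Group Q) (_ : Finite Q) (φ : A → Q),
    Function.Injective φ ∧ IsPartialHom A φ

/-- The relators `h⁻¹ k⁻¹ h k` with `h ∈ H v`, `k ∈ H w`, for `v`, `w` adjacent in `X`,
inside the free product of the groups `H v`. -/
def graphProductRels {V : Type*} (X : SimpleGraph V) (H : V → Type*) [∀ v, Group (H v)] :
    Set (Monoid.CoprodI H) :=
  {x | ∃ (v w : V), X.Adj v w ∧ ∃ (h : H v) (k : H w),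
    x = (Monoid.CoprodI.of h)⁻¹ * (Monoid.CoprodI.of k)⁻¹ *
      Monoid.CoprodI.of h * Monoid.CoprodI.of k}

/-- The graph product of the groups `H v` over the graph `X`: the quotient of their free product
by the normal closure of the relators above. -/
abbrev GraphProduct {V : Type*} (H : V → Type*) [∀ v, Group (H v)] (X : SimpleGraph V) : Type _ :=
  Monoid.CoprodI H ⧸ Subgroup.normalClosure (graphProductRels X H)

/-!
A group is LEF if and only if it has an asymptotic embedding into finite groups, so it suffices to
embed `GraphProduct H X` asymptotically into graph products of finite groups `K i v`, and to show
that the latter are LEF.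

Each `x` is the value of a reduced word, and by the normal form theorem a nonempty reduced word has
a nontrivial value. Asymptotic embeddings `φ i v` of the vertex groups eventually map a given
reduced word to a reduced word, so applying them letter by letter yields an asymptotic embedding of
the graph product.

Right multiplication by an element of `H v` moves `x` across the wall given by `v` and the coset of
`x` modulo the star of `v`, and wreath products attach to `x` a coordinate in `H v` at each such
wall. These coordinates determine `x`, whence the normal form theorem. If the vertex groups are
finite, then only finitely many `x` are supported in a given finite set `T` of walls. The letters
act on these by right multiplication, except that a letter fixes `x` when it would cross a wall
outside `T`. This respects the defining relations, since letters of adjacent vertices do not change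
each other's walls. As `T` grows, these finite permutation actions separate the elements of the
graph product.
-/

open Filter

/-- A family of maps `ψ i : Γ → G i` is an asymptotic embedding along the filter `L` if each
instance of `ψ i (g * h) = ψ i g * ψ i h` holds eventually and each `g ≠ 1` is eventually not sent
to `1`. -/
structure IsAsymptoticEmbedding {Γ I : Type*} [Group Γ] {G : I → Type*} [∀ i, Group (G i)]
    (L : Filter I) (ψ : ∀ i, Γ → G i) : Prop where
  eventually_map_mul : ∀ g h, ∀ᶠ i in L, ψ i (g * h) = ψ i g * ψ i h
  eventually_map_ne_one : ∀ g, g ≠ 1 → ∀ᶠ i in L, ψ i g ≠ 1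

section LEF

variable {Γ : Type*} [Group Γ]

theorem eventually_mem_atTop_finset {α : Type*} (a : α) : ∀ᶠ s : Finset α in atTop, a ∈ s :=
  (eventually_ge_atTop {a}).mono fun _ => Finset.singleton_subset_iff.1

theorem IsLEF.of_finite [Finite Γ] : IsLEF Γ := fun _ _ =>
  let e := (Shrink.mulEquiv : Shrink.{0} Γ ≃* Γ).symm
  ⟨Shrink.{0} Γ, inferInstance, inferInstance, fun a => e a,
    e.injective.comp Subtype.val_injective, fun g h _ => map_mul e (g : Γ) h⟩

theorem IsLEF.exists_isAsymptoticEmbedding (hΓ : IsLEF Γ) :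
    ∃ (Q : Finset Γ → Type) (_ : ∀ A, Group (Q A)) (_ : ∀ A, Finite (Q A)) (φ : ∀ A, Γ → Q A),
      IsAsymptoticEmbedding atTop φ := by
  choose Q _ _ φ hinj hmul using fun A : Finset Γ => hΓ A A.finite_toSet
  let ψ (A : Finset Γ) : Γ → Q A := Function.extend Subtype.val (φ A) 1
  have hψ {A : Finset Γ} {g : Γ} (hg : g ∈ A) : ψ A g = φ A ⟨g, hg⟩ :=
    Subtype.val_injective.extend_apply (φ A) 1 ⟨g, hg⟩
  have hψmul (g h : Γ) : ∀ᶠ A in atTop, ψ A (g * h) = ψ A g * ψ A h := by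
    filter_upwards [eventually_mem_atTop_finset g, eventually_mem_atTop_finset h,
      eventually_mem_atTop_finset (g * h)] with A hg hh hgh
    rw [hψ hg, hψ hh, hψ hgh]
    exact hmul A ⟨g, hg⟩ ⟨h, hh⟩ hgh
  refine ⟨Q, inferInstance, inferInstance, ψ, hψmul, fun g hg => ?_⟩
  filter_upwards [eventually_mem_atTop_finset g, eventually_mem_atTop_finset 1, hψmul 1 1]
    with A hgA h1A hone hg1
  have hψone : ψ A 1 = 1 := by simpa using hone
  rw [hψ hgA, ← hψone, hψ h1A] at hg1
  exact hg (congrArg Subtype.val (hinj A hg1))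

namespace IsAsymptoticEmbedding

variable {I : Type*} {G : I → Type*} [∀ i, Group (G i)] {L : Filter I} {ψ : ∀ i, Γ → G i}

theorem comp_tendsto (hψ : IsAsymptoticEmbedding L ψ) {J : Type*} {M : Filter J} {f : J → I}
    (hf : Tendsto f M L) : IsAsymptoticEmbedding M fun j => ψ (f j) where
  eventually_map_mul g h := hf.eventually (hψ.eventually_map_mul g h)
  eventually_map_ne_one g hg := hf.eventually (hψ.eventually_map_ne_one g hg)

theorem eventually_map_ne (hψ : IsAsymptoticEmbedding L ψ) {g h : Γ} (hgh : g ≠ h) :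
    ∀ᶠ i in L, ψ i g ≠ ψ i h := by
  filter_upwards [hψ.eventually_map_mul (g * h⁻¹) h,
    hψ.eventually_map_ne_one (g * h⁻¹) (mul_inv_eq_one.not.2 hgh)] with i hmul hne heq
  rw [inv_mul_cancel_right, heq, right_eq_mul] at hmul
  exact hne hmul

theorem isLEF [L.NeBot] (hψ : IsAsymptoticEmbedding L ψ) (hG : ∀ i, IsLEF (G i)) : IsLEF Γ := by
  intro A hA
  have hmul : ∀ᶠ i in L, ∀ g ∈ A, ∀ h ∈ A, ψ i (g * h) = ψ i g * ψ i h :=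
    (eventually_all_finite hA).2 fun g _ => (eventually_all_finite hA).2 fun h _ =>
      hψ.eventually_map_mul g h
  have hinj : ∀ᶠ i in L, ∀ g ∈ A, ∀ h ∈ A, g ≠ h → ψ i g ≠ ψ i h :=
    (eventually_all_finite hA).2 fun g _ => (eventually_all_finite hA).2 fun h _ =>
      eventually_imp_distrib_left.2 hψ.eventually_map_ne
  obtain ⟨i, hmul, hinj⟩ := (hmul.and hinj).exists
  obtain ⟨Q, _, _, φ, hφinj, hφmul⟩ := hG i (ψ i '' A) (hA.image _)
  refine ⟨Q, inferInstance, inferInstance,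
    fun a => φ ⟨ψ i a, Set.mem_image_of_mem _ a.2⟩, fun a b hab => ?_, fun g h hgh => ?_⟩
  · by_contra hne
    exact hinj a a.2 b b.2 (Subtype.coe_ne_coe.2 hne) (congrArg Subtype.val (hφinj hab))
  · have hψgh := hmul g g.2 h h.2
    refine Eq.trans (congrArg φ (Subtype.ext hψgh)) (hφmul ⟨ψ i g, _⟩ ⟨ψ i h, _⟩ ?_)
    exact hψgh ▸ Set.mem_image_of_mem (ψ i) hgh

end IsAsymptoticEmbedding

end LEF

namespace GraphProduct

variable {V : Type*} {X : SimpleGraph V} {H : V → Type*} [∀ v, Group (H v)]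

section Words

variable (X) in
/-- The canonical map of a vertex group to the graph product. -/
def of (v : V) : H v →* GraphProduct H X :=
  (QuotientGroup.mk' _).comp Monoid.CoprodI.of

theorem commute_of {v w : V} (hvw : X.Adj v w) (h : H v) (k : H w) :
    Commute (of X v h) (of X w k) := by
  have hrel : (of X v h)⁻¹ * (of X w k)⁻¹ * of X v h * of X w k = 1 :=
    (QuotientGroup.eq_one_iff _).2 (Subgroup.subset_normalClosure ⟨v, w, hvw, h, k, rfl⟩)
  rwa [mul_assoc, ← mul_inv_rev, inv_mul_eq_one, eq_comm] at hrel

/-- The universal property of the graph product: homomorphisms of the vertex groups whose images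
commute for adjacent vertices extend to the graph product. -/
def lift {M : Type*} [Monoid M] (f : ∀ v, H v →* M)
    (hf : ∀ v w, X.Adj v w → ∀ h k, Commute (f v h) (f w k)) : GraphProduct H X →* M :=
  QuotientGroup.lift _ (Monoid.CoprodI.lift f) <| by
    refine Subgroup.normalClosure_le_normal ?_
    rintro _ ⟨v, w, hvw, h, k, rfl⟩
    have hcomm := (hf v w hvw h k⁻¹).eq
    change Monoid.CoprodI.lift f _ = 1
    simp only [map_mul, ← map_inv, Monoid.CoprodI.lift_of]
    rw [mul_assoc (f v h⁻¹), ← hcomm, ← mul_assoc, ← map_mul, mul_assoc, ← map_mul]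
    simp

@[simp]
theorem lift_of {M : Type*} [Monoid M] (f : ∀ v, H v →* M)
    (hf : ∀ v w, X.Adj v w → ∀ h k, Commute (f v h) (f w k)) (v : V) (h : H v) :
    lift f hf (of X v h) = f v h :=
  Monoid.CoprodI.lift_of f h

theorem induction_left {p : GraphProduct H X → Prop} (x : GraphProduct H X) (one : p 1)
    (of_mul : ∀ v (h : H v) x, p x → p (of X v h * x)) : p x := by
  obtain ⟨y, rfl⟩ := QuotientGroup.mk'_surjective _ x
  induction y using Monoid.CoprodI.induction_left with
  | one => exact one
  | mul h y ih => exact of_mul _ h _ ih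

variable (X) in
/-- The element of the graph product represented by a word in the vertex groups. -/
def wordProd (l : List (Σ v, H v)) : GraphProduct H X :=
  (l.map fun a => of X a.1 a.2).prod

@[simp]
theorem wordProd_nil : wordProd X ([] : List (Σ v, H v)) = 1 := rfl

@[simp]
theorem wordProd_cons (a : Σ v, H v) (l : List (Σ v, H v)) :
    wordProd X (a :: l) = of X a.1 a.2 * wordProd X l := by
  simp [wordProd]

@[simp]
theorem wordProd_append (l m : List (Σ v, H v)) :
    wordProd X (l ++ m) = wordProd X l * wordProd X m := by
  simp [wordProd]

variable (X) in
theorem wordProd_surjective : Function.Surjective (wordProd X : List (Σ v, H v) → _) := fun x => by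
  induction x using induction_left with
  | one => exact ⟨[], wordProd_nil⟩
  | of_mul v h x ih =>
    obtain ⟨l, rfl⟩ := ih
    exact ⟨⟨v, h⟩ :: l, wordProd_cons _ _⟩

theorem commute_of_wordProd {v : V} (h : H v) (l : List (Σ v, H v))
    (hl : ∀ a ∈ l, X.Adj v a.1) : Commute (of X v h) (wordProd X l) :=
  Commute.list_prod_right _ _ <| List.forall_mem_map.2 fun a ha => commute_of (hl a ha) h a.2

variable (X) in
/-- A word is reduced if its letters are nontrivial and no two letters of the same vertex group
can be brought together by moving them past letters of adjacent vertices. -/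
structure IsReduced (l : List (Σ v, H v)) : Prop where
  ne_one : ∀ a ∈ l, a.2 ≠ 1
  exists_not_adj : ∀ v m, v :: (m ++ [v]) <:+: l.map Sigma.fst → ∃ w ∈ m, ¬ X.Adj v w

theorem IsReduced.of_infix {l m : List (Σ v, H v)} (hm : IsReduced X m) (hlm : l <:+: m) :
    IsReduced X l where
  ne_one a ha := hm.ne_one a (hlm.subset ha)
  exists_not_adj v s hs := hm.exists_not_adj v s (hs.trans (hlm.map _))

theorem IsReduced.map {K : V → Type*} [∀ v, Group (K v)] {l : List (Σ v, H v)}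
    (hl : IsReduced X l) (φ : ∀ v, H v → K v) (hφ : ∀ a ∈ l, φ a.1 a.2 ≠ 1) :
    IsReduced X (l.map (Sigma.map id φ)) where
  ne_one := List.forall_mem_map.2 hφ
  exists_not_adj := by
    rw [List.map_map]
    exact hl.exists_not_adj

theorem IsReduced.exists_ne_not_adj {l : List (Σ v, H v)} (hl : IsReduced X l) {v : V}
    {m : List V} (hm : v :: (m ++ [v]) <:+: l.map Sigma.fst) :
    ∃ w ∈ m, w ≠ v ∧ ¬ X.Adj v w := by
  -- Cut `m ++ [v]` at its first `v`, so that the piece before it does not contain `v`.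
  obtain ⟨s, t, hst, hvs⟩ :=
    List.eq_append_cons_of_mem (List.mem_append_right m (List.mem_singleton_self v))
  obtain ⟨w, hws, hvw⟩ := hl.exists_not_adj v s (.trans ⟨[], t, by simp [hst]⟩ hm)
  have hwv : w ≠ v := fun h => hvs (h ▸ hws)
  have hwm : w ∈ m ++ [v] := hst ▸ List.mem_append_left _ hws
  exact ⟨w, by simpa [hwv] using hwm, hwv, hvw⟩

theorem isReduced_of_forall_length_le {l : List (Σ v, H v)}
    (hl : ∀ m, wordProd X m = wordProd X l → l.length ≤ m.length) : IsReduced X l where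
  ne_one a ha h1 := by
    obtain ⟨p, q, rfl⟩ := List.append_of_mem ha
    have := hl (p ++ q) (by simp [h1])
    simp at this
  exists_not_adj v s hs := by
    by_contra! hadj
    obtain ⟨m, ⟨p, q, rfl⟩, hm⟩ := List.infix_map_iff.1 hs
    obtain ⟨h, m, k, rfl, rfl⟩ : ∃ (h : H v) (n : List (Σ v, H v)) (k : H v),
        m = ⟨v, h⟩ :: (n ++ [⟨v, k⟩]) ∧ s = n.map Sigma.fst := by
      obtain ⟨⟨_, h⟩, m, rfl, rfl, hm⟩ := List.map_eq_cons_iff.1 hm.symm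
      obtain ⟨n, m, rfl, rfl, hm'⟩ := List.map_eq_append_iff.1 hm
      obtain ⟨⟨_, k⟩, rfl, rfl⟩ := List.map_eq_singleton_iff.1 hm'
      exact ⟨h, n, k, rfl, rfl⟩
    have hcomm := commute_of_wordProd k m fun a ha => hadj _ (List.mem_map_of_mem ha)
    have := hl (p ++ ⟨v, h * k⟩ :: m ++ q) (by simp [hcomm.left_comm, mul_assoc])
    simp at this

theorem exists_isReduced (x : GraphProduct H X) : ∃ l, IsReduced X l ∧ wordProd X l = x := by
  obtain ⟨l, hl, hmin⟩ := exists_minimalFor_of_wellFoundedLT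
    (fun l => wordProd X l = x) List.length (wordProd_surjective X x)
  refine ⟨l, isReduced_of_forall_length_le fun m hm => ?_, hl⟩
  exact (le_total _ _).elim id (hmin (hm.trans hl))

end Words

section Coordinates

variable (X H) in
/-- The subgroup generated by the vertex groups of the vertices in `S`. -/
def parabolic (S : Set V) : Subgroup (GraphProduct H X) :=
  Subgroup.closure {x | ∃ v ∈ S, ∃ h, of X v h = x}

theorem of_mem_parabolic {S : Set V} {v : V} (hv : v ∈ S) (h : H v) :
    of X v h ∈ parabolic X H S :=
  Subgroup.subset_closure ⟨v, hv, h, rfl⟩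

variable (X H) in
/-- The parabolic subgroup of the star of `v`, the vertex `v` together with its neighbours. -/
abbrev star (v : V) : Subgroup (GraphProduct H X) := parabolic X H (insert v (X.neighborSet v))

variable (X H) in
/-- The walls of the graph product. The walls of type `v` are the cosets of `star X H v`; the coset
of `x` is the wall that separates `x` from `x * of X v h` for `h ≠ 1`. -/
abbrev Wall : Type _ := Σ v, GraphProduct H X ⧸ star X H v

/-- The wall that separates `x` from `x * of X v h` for `h ≠ 1`. -/
abbrev wall (v : V) (x : GraphProduct H X) : Wall X H := ⟨v, x⟩

open scoped Classical in
variable (X H) in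
/-- The element `h` of `H w` as a function on the walls of type `v`: it has value `h` at the coset
of `1` if `w = v`, and all its other values are `1`. -/
noncomputable def letterCoord (v w : V) : H w →* (GraphProduct H X ⧸ star X H v → H v) :=
  (MonoidHom.mulSingle (fun _ => H v) (QuotientGroup.mk 1)).comp
    ((Pi.evalMonoidHom H v).comp (MonoidHom.mulSingle H w))

theorem letterCoord_self (v : V) (h : H v) : letterCoord X H v v h (QuotientGroup.mk 1) = h := by
  simp [letterCoord]

theorem letterCoord_of_ne {v w : V} (hwv : w ≠ v) : letterCoord X H v w = 1 := by
  classical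
  ext1 h
  simp [letterCoord, Pi.mulSingle_eq_of_ne hwv.symm]

theorem letterCoord_apply_of_ne {v : V} (w : V) (h : H w) {c : GraphProduct H X ⧸ star X H v}
    (hc : c ≠ QuotientGroup.mk 1) : letterCoord X H v w h c = 1 := by
  classical
  exact Pi.mulSingle_eq_of_ne hc _

theorem commute_letterCoord (v : V) {w u : V} (hwu : w ≠ u) (h : H w) (k : H u) :
    Commute (letterCoord X H v w h) (letterCoord X H v u k) := by
  classical
  exact ((Pi.mulSingle_commute hwu h k).map (Pi.evalMonoidHom H v)).map
    (MonoidHom.mulSingle (fun _ : GraphProduct H X ⧸ star X H v => H v) (QuotientGroup.mk 1))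

theorem of_mem_star {v w : V} (hw : w = v ∨ X.Adj v w) (h : H w) : of X w h ∈ star X H v :=
  of_mem_parabolic (S := insert v (X.neighborSet v)) hw h

theorem of_smul_mk_one {v w : V} (hw : w = v ∨ X.Adj v w) (h : H w) :
    of X w h • (QuotientGroup.mk 1 : GraphProduct H X ⧸ star X H v) = QuotientGroup.mk 1 := by
  rw [← MulAction.mem_stabilizer_iff, MulAction.stabilizer_quotient]
  exact of_mem_star hw h

theorem mulAutArrow_letterCoord (v : V) {w u : V} (hu : u = w ∨ X.Adj w u) (h : H w) (k : H u) :
    mulAutArrow (of X u k) (letterCoord X H v w h) = letterCoord X H v w h := by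
  obtain rfl | hwv := eq_or_ne w v
  · have hfix := of_smul_mk_one hu k
    funext c
    change letterCoord X H w w h ((of X u k)⁻¹ • c) = letterCoord X H w w h c
    by_cases hc : c = QuotientGroup.mk 1
    · rw [hc, inv_smul_eq_iff.2 hfix.symm]
    · rw [letterCoord_apply_of_ne _ _ hc, letterCoord_apply_of_ne]
      rwa [ne_eq, inv_smul_eq_iff, hfix]
  · rw [letterCoord_of_ne hwv, MonoidHom.one_apply, map_one]

variable (X H) in
/-- The component on `H w` of the homomorphism `toWreath` below. -/
noncomputable def letterWreath (v w : V) :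
    H w →* (GraphProduct H X ⧸ star X H v → H v) ⋊[mulAutArrow] GraphProduct H X where
  toFun h := ⟨letterCoord X H v w h, of X w h⟩
  map_one' := by ext1 <;> simp
  map_mul' h k := by
    ext1
    · exact (map_mul _ h k).trans
        (congrArg (_ * ·) (mulAutArrow_letterCoord v (.inl rfl) k h).symm)
    · exact map_mul _ h k

variable (X H) in
/-- The homomorphism of the graph product to the unrestricted wreath product of `H v` over the
walls of type `v`. -/
noncomputable def toWreath (v : V) :
    GraphProduct H X →* (GraphProduct H X ⧸ star X H v → H v) ⋊[mulAutArrow] GraphProduct H X :=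
  lift (letterWreath X H v) <| by
    intro w u hwu h k
    ext1
    · change letterCoord X H v w h * mulAutArrow (of X w h) (letterCoord X H v u k) =
        letterCoord X H v u k * mulAutArrow (of X u k) (letterCoord X H v w h)
      rw [mulAutArrow_letterCoord v (.inr hwu), mulAutArrow_letterCoord v (.inr hwu.symm),
        (commute_letterCoord v hwu.ne h k).eq]
    · exact (commute_of hwu h k).eq

theorem toWreath_of (v w : V) (h : H w) :
    toWreath X H v (of X w h) = ⟨letterCoord X H v w h, of X w h⟩ := lift_of _ _ w h

theorem toWreath_right (v : V) (x : GraphProduct H X) : (toWreath X H v x).right = x := by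
  induction x using induction_left with
  | one => simp
  | of_mul w h x ih => rw [map_mul, toWreath_of, SemidirectProduct.mul_right, ih]

/-- The coordinates of `x` at the walls of type `v`. They generalize the coordinates of a direct
product, and are nontrivial at the walls that separate `x` from `1`. -/
noncomputable def coord (v : V) (x : GraphProduct H X) : GraphProduct H X ⧸ star X H v → H v :=
  (toWreath X H v x).left

@[simp]
theorem coord_one (v : V) : coord v (1 : GraphProduct H X) = 1 := by
  simp [coord]

theorem coord_mul (v : V) (x y : GraphProduct H X) (c : GraphProduct H X ⧸ star X H v) :
    coord v (x * y) c = coord v x c * coord v y (x⁻¹ • c) := by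
  rw [coord, map_mul, SemidirectProduct.mul_left, toWreath_right]
  rfl

theorem coord_of (v w : V) (h : H w) : coord v (of X w h) = letterCoord X H v w h := by
  rw [coord, toWreath_of]

theorem coord_eq_one_of_mem_parabolic {S : Set V} {v : V} (hv : v ∉ S) {x : GraphProduct H X}
    (hx : x ∈ parabolic X H S) : coord v x = 1 := by
  have hle : parabolic X H S ≤ SemidirectProduct.inr.range.comap (toWreath X H v) := by
    refine (Subgroup.closure_le _).2 ?_
    rintro _ ⟨w, hw, h, rfl⟩
    have hwv : w ≠ v := fun hwv => hv (hwv ▸ hw)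
    exact ⟨of X w h, by rw [toWreath_of, letterCoord_of_ne hwv]; rfl⟩
  obtain ⟨y, hy⟩ := hle hx
  rw [coord, ← hy, SemidirectProduct.left_inr]

theorem exists_eq_append_of_coord_wordProd_ne_one {v : V} {l : List (Σ v, H v)}
    {c : GraphProduct H X ⧸ star X H v} (hc : coord v (wordProd X l) c ≠ 1) :
    ∃ p h q, l = p ++ ⟨v, h⟩ :: q ∧ c = QuotientGroup.mk (wordProd X p) := by
  induction l generalizing c with
  | nil => simp at hc
  | cons a l ih =>
    obtain ⟨w, h⟩ := a
    rw [wordProd_cons, coord_mul, coord_of] at hc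
    by_cases hl : coord v (wordProd X l) ((of X w h)⁻¹ • c) = 1
    · rw [hl, mul_one] at hc
      obtain rfl : w = v := by
        by_contra hwv
        exact hc (by simp [letterCoord_of_ne hwv])
      exact ⟨[], h, l, rfl, by_contra fun hne => hc (letterCoord_apply_of_ne _ _ hne)⟩
    · obtain ⟨p, k, q, rfl, hp⟩ := ih hl
      exact ⟨⟨w, h⟩ :: p, k, q, rfl, by rw [wordProd_cons, ← smul_eq_mul,
        ← MulAction.Quotient.smul_mk, ← hp, smul_inv_smul]⟩

theorem coord_of_mul_mk_one (v : V) (h : H v) (x : GraphProduct H X) :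
    coord v (of X v h * x) (QuotientGroup.mk 1) = h * coord v x (QuotientGroup.mk 1) := by
  rw [coord_mul, coord_of, letterCoord_self, inv_smul_eq_iff.2 (of_smul_mk_one (.inl rfl) h).symm]

theorem coord_of_mul_smul {v w : V} (h : H w) (x : GraphProduct H X)
    {c : GraphProduct H X ⧸ star X H v} (hc : w = v → c ≠ QuotientGroup.mk 1) :
    coord v (of X w h * x) (of X w h • c) = coord v x c := by
  suffices letterCoord X H v w h (of X w h • c) = 1 by
    rw [coord_mul, coord_of, this, one_mul, inv_smul_smul]
  obtain rfl | hwv := eq_or_ne w v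
  · refine letterCoord_apply_of_ne w h fun heq => hc rfl (smul_left_cancel (of X w h) ?_)
    rw [heq, of_smul_mk_one (.inl rfl)]
  · simp [letterCoord_of_ne hwv]

theorem IsReduced.exists_coord_ne_one {l : List (Σ v, H v)} (hl : IsReduced X l) (a : Σ v, H v)
    (ha : a ∈ l) : ∃ c, coord a.1 (wordProd X l) c ≠ 1 := by
  induction hn : l.length using Nat.strong_induction_on generalizing l a with
  | _ n ih =>
  subst hn
  rcases l with _ | ⟨⟨v, h⟩, t⟩
  · simp at ha
  -- A nontrivial coordinate of `t` at the coset of `1` comes from a prefix of `t` in the star of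
  -- `v`, but this prefix has a letter outside that star and, by induction, a coordinate there.
  have hbase : coord v (wordProd X t) (QuotientGroup.mk 1) = 1 := by
    by_contra hne
    obtain ⟨p, k, q, rfl, hp⟩ := exists_eq_append_of_coord_wordProd_ne_one hne
    have hpstar : wordProd X p ∈ star X H v := by simpa using QuotientGroup.eq.1 hp
    obtain ⟨w, hw, hwv, hvw⟩ := hl.exists_ne_not_adj (v := v) (m := p.map Sigma.fst)
      ⟨[], q.map Sigma.fst, by simp⟩
    obtain ⟨b, hb, rfl⟩ := List.mem_map.1 hw
    obtain ⟨c, hc⟩ := ih p.length (by simp)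
      (hl.of_infix ⟨[⟨v, h⟩], ⟨v, k⟩ :: q, by simp⟩) b hb rfl
    exact hc (congrFun (coord_eq_one_of_mem_parabolic (by simp [hwv, hvw]) hpstar) c)
  rw [wordProd_cons]
  rcases List.mem_cons.1 ha with rfl | hat
  · refine ⟨QuotientGroup.mk 1, ?_⟩
    rw [coord_of_mul_mk_one, hbase, mul_one]
    exact hl.ne_one _ ha
  · obtain ⟨c, hc⟩ := ih t.length (by simp) (hl.of_infix (List.infix_cons (List.infix_refl t)))
      a hat rfl
    refine ⟨of X v h • c, ?_⟩
    rwa [coord_of_mul_smul h _ fun hva => ?_]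
    rintro rfl
    subst hva
    exact hc hbase

theorem IsReduced.wordProd_ne_one {l : List (Σ v, H v)} (hl : IsReduced X l) (hne : l ≠ []) :
    wordProd X l ≠ 1 := by
  obtain ⟨a, ha⟩ := List.exists_mem_of_ne_nil l hne
  obtain ⟨c, hc⟩ := hl.exists_coord_ne_one a ha
  intro h1
  simp [h1] at hc

theorem ext_coord {x y : GraphProduct H X} (hxy : ∀ v, coord v x = coord v y) : x = y := by
  obtain ⟨l, hl, hlprod⟩ := exists_isReduced (x⁻¹ * y)
  suffices l = [] by
    rwa [this, wordProd_nil, eq_comm, inv_mul_eq_one] at hlprod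
  refine List.eq_nil_iff_forall_not_mem.2 fun a ha => ?_
  obtain ⟨c, hc⟩ := hl.exists_coord_ne_one a ha
  have hcoord := coord_mul a.1 x (x⁻¹ * y) (x • c)
  rw [mul_inv_cancel_left, inv_smul_smul, ← hlprod, hxy, left_eq_mul] at hcoord
  exact hc hcoord

end Coordinates

section Truncation

/-- The elements of the graph product that are separated from `1` only by walls in `T`. -/
def supportedIn (T : Set (Wall X H)) : Set (GraphProduct H X) :=
  {x | ∀ v c, coord v x c ≠ 1 → ⟨v, c⟩ ∈ T}

theorem one_mem_supportedIn (T : Set (Wall X H)) : 1 ∈ supportedIn T := by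
  simp [supportedIn]

theorem mul_of_mem_supportedIn {T : Set (Wall X H)} {x : GraphProduct H X} {v : V}
    (hx : x ∈ supportedIn T) (hxT : wall v x ∈ T) (h : H v) : x * of X v h ∈ supportedIn T := by
  intro u c hc
  rw [coord_mul, coord_of] at hc
  by_cases hxc : coord u x c = 1
  · rw [hxc, one_mul] at hc
    obtain rfl : v = u := by
      by_contra hvu
      exact hc (by simp [letterCoord_of_ne hvu])
    have hxc : x⁻¹ • c = QuotientGroup.mk 1 := by_contra fun hne =>
      hc (letterCoord_apply_of_ne _ _ hne)
    rw [inv_smul_eq_iff, MulAction.Quotient.smul_mk, smul_eq_mul, mul_one] at hxc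
    exact hxc ▸ hxT
  · exact hx u c hxc

theorem finite_supportedIn [∀ v, Finite (H v)] {T : Set (Wall X H)} (hT : T.Finite) :
    (supportedIn T).Finite := by
  have := hT.to_subtype
  refine Set.Finite.of_injOn (f := fun x (W : T) => coord W.1.1 x W.1.2) (t := Set.univ)
    (fun _ _ => Set.mem_univ _) (fun x hx y hy hxy => ?_) Set.finite_univ
  refine ext_coord fun v => funext fun c => ?_
  by_cases hW : (⟨v, c⟩ : Wall X H) ∈ T
  · exact congrFun hxy ⟨⟨v, c⟩, hW⟩
  · rw [not_imp_comm.1 (hx v c) hW, not_imp_comm.1 (hy v c) hW]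

theorem wall_mul_of {v w : V} (hw : w = v ∨ X.Adj v w) (h : H w) (x : GraphProduct H X) :
    wall v (x * of X w h) = wall v x :=
  congrArg (Sigma.mk v) (QuotientGroup.mk_mul_of_mem x (of_mem_star hw h))

open scoped Classical in
/-- Right multiplication by an element of a vertex group, truncated so as to cross only walls
in `T`. -/
noncomputable def truncMul {T : Set (Wall X H)} (x : supportedIn T) {v : V} (h : H v) :
    supportedIn T :=
  if hx : wall v x.1 ∈ T then ⟨x * of X v h, mul_of_mem_supportedIn x.2 hx h⟩ else x

theorem coe_truncMul_of_mem {T : Set (Wall X H)} {x : supportedIn T} {v : V}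
    (hx : wall v x.1 ∈ T) (h : H v) : (truncMul x h : GraphProduct H X) = x * of X v h := by
  rw [truncMul, dif_pos hx]

theorem truncMul_of_notMem {T : Set (Wall X H)} {x : supportedIn T} {v : V}
    (hx : wall v x.1 ∉ T) (h : H v) : truncMul x h = x :=
  dif_neg hx

theorem truncMul_one {T : Set (Wall X H)} (x : supportedIn T) {v : V} :
    truncMul x (1 : H v) = x := by
  by_cases hx : wall v x.1 ∈ T
  · exact Subtype.ext (by rw [coe_truncMul_of_mem hx, map_one, mul_one])
  · exact truncMul_of_notMem hx 1

theorem wall_truncMul {T : Set (Wall X H)} (x : supportedIn T) {v w : V}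
    (hw : w = v ∨ X.Adj v w) (h : H w) : wall v (truncMul x h).1 = wall v x.1 := by
  by_cases hx : wall w x.1 ∈ T
  · rw [coe_truncMul_of_mem hx, wall_mul_of hw]
  · rw [truncMul_of_notMem hx]

theorem truncMul_truncMul {T : Set (Wall X H)} (x : supportedIn T) {v : V} (h k : H v) :
    truncMul (truncMul x h) k = truncMul x (h * k) := by
  by_cases hx : wall v x.1 ∈ T
  · have hxh : wall v (truncMul x h).1 ∈ T := by rwa [wall_truncMul x (.inl rfl)]
    refine Subtype.ext ?_
    rw [coe_truncMul_of_mem hxh, coe_truncMul_of_mem hx, coe_truncMul_of_mem hx, map_mul, mul_assoc]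
  · rw [truncMul_of_notMem hx h, truncMul_of_notMem hx, truncMul_of_notMem hx]

theorem truncMul_comm {T : Set (Wall X H)} (x : supportedIn T) {v w : V} (hvw : X.Adj v w)
    (h : H v) (k : H w) : truncMul (truncMul x h) k = truncMul (truncMul x k) h := by
  have hxh := wall_truncMul x (.inr hvw.symm) h
  have hxk := wall_truncMul x (.inr hvw) k
  by_cases hv : wall v x.1 ∈ T
  · by_cases hw : wall w x.1 ∈ T
    · refine Subtype.ext ?_
      rw [coe_truncMul_of_mem (by rwa [hxh]), coe_truncMul_of_mem hv,
        coe_truncMul_of_mem (by rwa [hxk]), coe_truncMul_of_mem hw, mul_assoc, mul_assoc,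
        (commute_of hvw h k).eq]
    · rw [truncMul_of_notMem (by rwa [hxh]), truncMul_of_notMem hw]
  · rw [truncMul_of_notMem hv, truncMul_of_notMem (x := truncMul x k) (by rwa [hxk])]

/-- The left action of a vertex group on `supportedIn T` by `truncMul`; right multiplication
becomes a left action through inverses. -/
noncomputable def truncPermOf (T : Set (Wall X H)) (v : V) : H v →* Equiv.Perm (supportedIn T) :=
  letI : MulAction (H v) (supportedIn T) :=
    { smul := fun h x => truncMul x h⁻¹
      one_smul := fun x => by
        change truncMul x 1⁻¹ = x
        rw [inv_one, truncMul_one]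
      mul_smul := fun h k x => by
        change truncMul x (h * k)⁻¹ = truncMul (truncMul x k⁻¹) h⁻¹
        rw [truncMul_truncMul, mul_inv_rev] }
  MulAction.toPermHom (H v) (supportedIn T)

theorem commute_truncPermOf (T : Set (Wall X H)) {v w : V} (hvw : X.Adj v w) (h : H v) (k : H w) :
    Commute (truncPermOf T v h) (truncPermOf T w k) :=
  Equiv.ext fun x => truncMul_comm x hvw.symm k⁻¹ h⁻¹

/-- The action of the graph product on `supportedIn T` that extends the truncated actions
`truncPermOf T v` of the vertex groups. -/
noncomputable def truncPerm (T : Set (Wall X H)) : GraphProduct H X →* Equiv.Perm (supportedIn T) :=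
  lift (truncPermOf T) fun _ _ => commute_truncPermOf T

theorem truncPerm_of_apply (T : Set (Wall X H)) {v : V} (h : H v) (x : supportedIn T) :
    truncPerm T (of X v h) x = truncMul x h⁻¹ := by
  rw [truncPerm, lift_of]
  rfl

theorem eventually_truncPerm_one (x : GraphProduct H X) :
    ∀ᶠ T : Finset (Wall X H) in atTop,
      (truncPerm (T : Set (Wall X H)) x ⟨1, one_mem_supportedIn _⟩ : GraphProduct H X) = x⁻¹ := by
  induction x using induction_left with
  | one => simp only [map_one, Equiv.Perm.one_apply, inv_one, eventually_const]
  | of_mul v h x ih =>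
    filter_upwards [ih, eventually_mem_atTop_finset (wall v x⁻¹)] with T hT hmem
    rw [map_mul, Equiv.Perm.mul_apply, truncPerm_of_apply, coe_truncMul_of_mem (by rwa [hT]),
      hT, map_inv, mul_inv_rev]

theorem isLEF_of_finite [∀ v, Finite (H v)] : IsLEF (GraphProduct H X) := by
  have htrunc : IsAsymptoticEmbedding atTop
      fun T : Finset (Wall X H) => truncPerm (T : Set (Wall X H)) :=
    { eventually_map_mul g h := .of_forall fun T => map_mul _ g h
      eventually_map_ne_one g hg := by
        filter_upwards [eventually_truncPerm_one g] with T hT h1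
        rw [h1, Equiv.Perm.one_apply] at hT
        exact hg (inv_eq_one.1 hT.symm) }
  refine htrunc.isLEF fun T => ?_
  have := (finite_supportedIn (T.finite_toSet)).to_subtype
  exact .of_finite

end Truncation

section Functoriality

variable {I : Type*} {L : Filter I} {K : I → V → Type*} [∀ i v, Group (K i v)]

variable (L) in
/-- The congruence on a product of groups that identifies families that agree eventually. -/
def eventuallyEqCon (G : I → Type*) [∀ i, Group (G i)] : Con (∀ i, G i) where
  __ := L.productSetoid G
  mul' hab hcd := by
    filter_upwards [hab, hcd] with i hab hcd
    exact congrArg₂ (· * ·) hab hcd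

theorem eventually_wordProd_map_eq {φ : ∀ i v, H v → K i v}
    (hφ : ∀ v, IsAsymptoticEmbedding L fun i => φ i v) {l m : List (Σ v, H v)}
    (hlm : wordProd X l = wordProd X m) :
    ∀ᶠ i in L, wordProd X (l.map (Sigma.map id (φ i))) =
      wordProd X (m.map (Sigma.map id (φ i))) := by
  let C := eventuallyEqCon L fun i => GraphProduct (K i) X
  let f (v : V) : H v →* C.Quotient :=
    MonoidHom.mk' (fun h => C.mk' fun i => of X v (φ i v h)) <| by
      intro g h
      refine C.eq.2 ?_
      filter_upwards [(hφ v).eventually_map_mul g h] with i hi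
      simp [hi]
  have hf (v w : V) (hvw : X.Adj v w) (h : H v) (k : H w) : Commute (f v h) (f w k) :=
    congrArg _ (funext fun i => (commute_of hvw (φ i v h) (φ i w k)).eq)
  have hlift (l : List (Σ v, H v)) : lift f hf (wordProd X l) =
      C.mk' fun i => wordProd X (l.map (Sigma.map id (φ i))) := by
    induction l with
    | nil => exact map_one _
    | cons a l ih =>
      rw [wordProd_cons, map_mul, ih, lift_of]
      exact congrArg C.mk' (funext fun i => (wordProd_cons (Sigma.map id (φ i) a) _).symm)
  exact C.eq.1 ((hlift l).symm.trans ((congrArg _ hlm).trans (hlift m)))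

variable (X) in
theorem exists_isAsymptoticEmbedding {φ : ∀ i v, H v → K i v}
    (hφ : ∀ v, IsAsymptoticEmbedding L fun i => φ i v) :
    ∃ ψ : ∀ i, GraphProduct H X → GraphProduct (K i) X, IsAsymptoticEmbedding L ψ := by
  choose word hword hprod using exists_isReduced (X := X) (H := H)
  refine ⟨fun i x => wordProd X ((word x).map (Sigma.map id (φ i))), fun x y => ?_, fun x hx => ?_⟩
  · have heq : wordProd X (word (x * y)) = wordProd X (word x ++ word y) := by
      rw [wordProd_append, hprod, hprod, hprod]
    filter_upwards [eventually_wordProd_map_eq hφ heq] with i hi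
    rw [hi, List.map_append, wordProd_append]
  · have hne : ∀ᶠ i in L, ∀ a ∈ {a | a ∈ word x}, φ i a.1 a.2 ≠ 1 :=
      (eventually_all_finite (word x).finite_toSet).2 fun a ha =>
        (hφ a.1).eventually_map_ne_one a.2 ((hword x).ne_one a ha)
    filter_upwards [hne] with i hi
    refine ((hword x).map (φ i) hi).wordProd_ne_one fun hnil => hx ?_
    rw [← hprod x, List.map_eq_nil_iff.1 hnil, wordProd_nil]

end Functoriality

end GraphProduct

theorem mainTheorem8 {V : Type*} (X : SimpleGraph V) (H : V → Type*) [∀ v, Group (H v)]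
    (hH : ∀ v, IsLEF (H v)) : IsLEF (GraphProduct H X) := by
  choose Q _ _ φ hφ using fun v => (hH v).exists_isAsymptoticEmbedding
  have hφ' (v : V) : IsAsymptoticEmbedding (Filter.pi fun v => (atTop : Filter (Finset (H v))))
      fun A => φ v (A v) := (hφ v).comp_tendsto (tendsto_eval_pi _ v)
  obtain ⟨ψ, hψ⟩ := GraphProduct.exists_isAsymptoticEmbedding X hφ'
  exact hψ.isLEF fun A => GraphProduct.isLEF_of_finite
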